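/- Let $\mathcal E$ be a finite-dimensional Euclidean affine space with translation vector space $\mathcal V$, and let $\Pi$ be a Bieberbach group in $\mathcal E$, that is, a torsion-free discrete group of isometries of $\mathcal E$ for which some compact subset of $\mathcal E$ meets every $\Pi$-orbit. Let $L=\Pi\cap\mathcal V$ be the group of all translations in $\Pi$, and let the holonomy group $H$ consist of the linear parts of all elements of $\Pi$. An $L$-subspace is a vector subspace $\mathcal V_0\subseteq\mathcal V$ spanned by $L\cap\mathcal V_0$. Put $\mathcal M=\mathcal E/\Pi$ and $\mathcal T=\mathcal E/L$, with the natural projection $\mathcal T\to\mathcal M$. A coset $\mathcal E_0$ of an $H$-invariant $L$-subspace $\mathcal V_0$ in $\mathcal E$ is called generic if every element of $\Pi$ mapping $\mathcal E_0$ onto itself maps every coset of $\mathcal V_0$ onto itself. Let $\mathcal V'$ and $\mathcal V''$ be $H$-invariant $L$-subspaces of $\mathcal V$ with $\mathcal V=\mathcal V'\oplus\mathcal V''$, and let $\mathcal E',\mathcal E''$ be generic cosets of $\mathcal V',\mathcal V''$ in $\mathcal E$. Let $\mathcal M',\mathcal M''\subseteq\mathcal M$ and $\mathcal T',\mathcal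 T''\subseteq\mathcal T$ be the images of $\mathcal E',\mathcal E''$ under the quotient projections. Let $\Pi',\Pi''\subseteq\Pi$ be the stabilizer groups of $\mathcal E',\mathcal E''$, let $L'=L\cap\mathcal V'$ and $L''=L\cap\mathcal V''$, and let $H',H''\subseteq H$ consist of the linear parts of all elements of $\Pi'$ and, respectively, $\Pi''$. Then $\Pi'\Pi''$, $L'L''$ and $H'H''$ are normal subgroups of $\Pi$, $L$ and $H$, and, with the quotient groups $$\hat\Pi=\Pi/(\Pi'\Pi''),\qquad \hat L=L/(L'L''),\qquad \hat H=H/(H'H''),$$ the following hold. (a) $\mathcal M'\cap\mathcal M''$ and $\mathcal T'\cap\mathcal T''$ are finite, and are in bijective correspondence with $\hat\Pi$ and, respectively, $\hat L$. (b) The projection $\mathcal T\to\mathcal M$ maps $\mathcal T'\cap\mathcal T''$ injectively into $\mathcal M'\cap\mathcal M''$. (c) $\hat H$ is finite and $|\mathcal M'\cap\mathcal M''|=|\mathcal T'\cap\mathcal T''|\cdot|\hat H|$. (d) $\mathcal T'\cap\mathcal T''$ is finite and in bijective correspondence with $\hat L$ also when $\mathcal E'$ and $\mathcal E''$ are arbitrary,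 not necessarily generic, cosets of $\mathcal V'$ and $\mathcal V''$. (e) The two bijections in (a) may be chosen so that, under the resulting identifications, the mapping $\mathcal T'\cap\mathcal T''\to\mathcal M'\cap\mathcal M''$ of (b) coincides with the group homomorphism $\hat L\to\hat\Pi$ induced by the inclusion $L\to\Pi$. -/

import Mathlib

namespace FlatManifold

noncomputable section

variable {V E : Type*} [NormedAddCommGroup V] [InnerProductSpace ℝ V]
  [MetricSpace E] [NormedAddTorsor V E]

/-- The compact-open topology on the group of (affine) isometries of `E`. -/
instance isometryTopology : TopologicalSpace (E ≃ᵃⁱ[ℝ] E) :=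
  TopologicalSpace.induced (fun γ => (⟨γ, γ.continuous⟩ : C(E, E))) inferInstance

/-- Bieberbach groups: torsion-free discrete groups of isometries of a Euclidean affine space
having a compact fundamental domain (a compact set that meets every orbit). -/
structure IsBieberbach (Γ : Subgroup (E ≃ᵃⁱ[ℝ] E)) : Prop where
  discrete : DiscreteTopology Γ
  torsionFree : ∀ γ ∈ Γ, γ ≠ 1 → ¬ IsOfFinOrder γ
  cocompact : ∃ K : Set E, IsCompact K ∧ ∀ x : E, ∃ γ ∈ Γ, γ x ∈ K

/-- The homomorphism sending an isometry to its linear part. -/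
def linearPart : (E ≃ᵃⁱ[ℝ] E) →* (V ≃ₗᵢ[ℝ] V) where
  toFun γ := γ.linearIsometryEquiv
  map_one' := rfl
  map_mul' _ _ := rfl

variable (E) in
/-- The group of translations of `E` by the vectors in a subspace `W`. -/
def translations (W : Submodule ℝ V) : Subgroup (E ≃ᵃⁱ[ℝ] E) where
  carrier := {γ | ∃ w ∈ W, γ = AffineIsometryEquiv.constVAdd ℝ E w}
  one_mem' := ⟨0, W.zero_mem, by ext x; simp⟩
  mul_mem' := by
    rintro _ _ ⟨v, hv, rfl⟩ ⟨w, hw, rfl⟩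
    exact ⟨v + w, W.add_mem hv hw, by ext x; simp [add_vadd]⟩
  inv_mem' := by
    rintro _ ⟨w, hw, rfl⟩
    refine ⟨-w, W.neg_mem hw, ?_⟩
    rw [inv_eq_iff_mul_eq_one]
    ext x
    simp

/-- The lattice subgroup `L` of `Γ`, formed by all the translations lying in `Γ`. -/
def latticeSubgroup (Γ : Subgroup (E ≃ᵃⁱ[ℝ] E)) : Subgroup (E ≃ᵃⁱ[ℝ] E) :=
  Γ ⊓ translations E ⊤

/-- The holonomy group of `Γ`, formed by the linear parts of all the elements of `Γ`. -/
def holonomyGroup (Γ : Subgroup (E ≃ᵃⁱ[ℝ] E)) : Subgroup (V ≃ₗᵢ[ℝ] V) :=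
  Γ.map linearPart

/-- `W` is an `L`-subspace: it is spanned by the vectors in `W` that, as translations,
lie in `L`. -/
def IsLSubspace (L : Subgroup (E ≃ᵃⁱ[ℝ] E)) (W : Submodule ℝ V) : Prop :=
  Submodule.span ℝ {w : V | w ∈ W ∧ AffineIsometryEquiv.constVAdd ℝ E w ∈ L} = W

/-- `W` is invariant under the group `H` of linear isometries. -/
def IsInvariant (H : Subgroup (V ≃ₗᵢ[ℝ] V)) (W : Submodule ℝ V) : Prop :=
  ∀ A ∈ H, ∀ w ∈ W, A w ∈ W

/-- `F` is a coset of `W` in `E`, that is, an affine subspace `x + W` parallel to `W`. -/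
def IsCoset (W : Submodule ℝ V) (F : AffineSubspace ℝ E) : Prop :=
  ∃ x : E, F = AffineSubspace.mk' x W

/-- The stabilizer group in `Γ` of an affine subspace `F`: the elements of `Γ` mapping `F`
onto itself. -/
def stabilizer (Γ : Subgroup (E ≃ᵃⁱ[ℝ] E)) (F : AffineSubspace ℝ E) :
    Subgroup (E ≃ᵃⁱ[ℝ] E) where
  carrier := {γ | γ ∈ Γ ∧ γ '' (F : Set E) = F}
  one_mem' := ⟨Γ.one_mem, by simp⟩
  mul_mem' := by
    rintro γ δ ⟨hγ, hγF⟩ ⟨hδ, hδF⟩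
    refine ⟨Γ.mul_mem hγ hδ, ?_⟩
    rw [AffineIsometryEquiv.coe_mul, Set.image_comp, hδF, hγF]
  inv_mem' := by
    rintro γ ⟨hγ, hγF⟩
    refine ⟨Γ.inv_mem hγ, ?_⟩
    conv_lhs => rw [← hγF]
    rw [← Set.image_comp, ← AffineIsometryEquiv.coe_mul, inv_mul_cancel]
    simp

/-- The kernel of the action of `Γ` on the space `E / W` of all cosets of `W`: the elements of
`Γ` mapping every coset of `W` onto itself. -/
def leafKernel (Γ : Subgroup (E ≃ᵃⁱ[ℝ] E)) (W : Submodule ℝ V) : Subgroup (E ≃ᵃⁱ[ℝ] E) :=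
  Γ ⊓ ⨅ (F : AffineSubspace ℝ E) (_ : IsCoset W F), stabilizer Γ F

/-- `F` is a generic coset of `W`: its stabilizer is the kernel of the action on `E / W`. -/
def IsGenericCoset (Γ : Subgroup (E ≃ᵃⁱ[ℝ] E)) (W : Submodule ℝ V)
    (F : AffineSubspace ℝ E) : Prop :=
  IsCoset W F ∧ stabilizer Γ F = leafKernel Γ W

/-- The equivalence relation on `E` whose classes are the orbits of `Γ`. -/
def orbitSetoid (Γ : Subgroup (E ≃ᵃⁱ[ℝ] E)) : Setoid E where
  r x y := ∃ γ ∈ Γ, γ x = y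
  iseqv :=
    { refl := fun _ => ⟨1, Γ.one_mem, rfl⟩
      symm := by
        rintro x _ ⟨γ, hγ, rfl⟩
        exact ⟨γ⁻¹, Γ.inv_mem hγ, γ.symm_apply_apply x⟩
      trans := by
        rintro x _ _ ⟨γ, hγ, rfl⟩ ⟨δ, hδ, rfl⟩
        exact ⟨δ * γ, Γ.mul_mem hδ hγ, rfl⟩ }

/-- The quotient `E / Γ`: the flat manifold when `Γ` is a Bieberbach group, and
a flat torus when `Γ` is replaced with its lattice subgroup. -/
abbrev OrbitSpace (Γ : Subgroup (E ≃ᵃⁱ[ℝ] E)) : Type _ := Quotient (orbitSetoid Γ)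

/-- The projection `E → E / Γ`. -/
def proj (Γ : Subgroup (E ≃ᵃⁱ[ℝ] E)) : E → OrbitSpace Γ := Quotient.mk (orbitSetoid Γ)

/-- The image in `E / Γ` of an affine subspace of `E`. -/
def leaf (Γ : Subgroup (E ≃ᵃⁱ[ℝ] E)) (F : AffineSubspace ℝ E) : Set (OrbitSpace Γ) :=
  proj Γ '' (F : Set E)

/-- The projection of the torus `E / L` onto `E / Γ`, for the lattice subgroup `L` of `Γ`. -/
def torusProj (Γ : Subgroup (E ≃ᵃⁱ[ℝ] E)) :
    OrbitSpace (latticeSubgroup Γ) → OrbitSpace Γ :=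
  Quotient.map' id fun _ _ ⟨γ, hγ, h⟩ => ⟨γ, hγ.1, h⟩

end

end FlatManifold

/-! The cosets `E₁`, `E₂` meet in a point `o`. For `γ ∈ Γ`, invariance of `V₁` makes `γ E₁` again a
coset of `V₁`, so it meets `E₂` in exactly one point `f γ`. The projections of these points exhaust
`M₁ ∩ M₂`, and `f γ`, `f γ'` have the same projection iff `γ' ∈ Γ₂ γ Γ₁`. Genericity makes `Γ₁`,
`Γ₂` normal, so these double cosets are the cosets of `Γ₁Γ₂` (`exists_equiv_leaf_inter`). For `L`
every coset is generic, which gives the torus bijection with no assumption on the cosets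
(`exists_equiv_torus_leaf_inter`). Both bijections come from the same formula, hence agree with `L →
Γ`.

Injectivity amounts to `L ∩ Γ₁Γ₂ = L₁L₂` (`latticeSubgroup_inf_sup`). As `L` is the kernel of the
linear part on `Γ`, multiplicativity of indices turns this into the counting formula
(`relIndex_eq_relIndex_inf_ker_mul`). Finiteness holds because bounded sets contain finitely many
lattice vectors, while `L₁L₂` contains a basis of `V`. -/

namespace FlatManifold

open AffineSubspace Module

/-! ### Leaf intersections as quotient groups -/

section Bijection

variable {V E : Type*} [NormedAddCommGroup V] [InnerProductSpace ℝ V]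
  [MetricSpace E] [NormedAddTorsor V E] {G : Subgroup (E ≃ᵃⁱ[ℝ] E)} {W V₁ V₂ : Submodule ℝ V}

lemma linearPart_vsub (γ : E ≃ᵃⁱ[ℝ] E) (x y : E) :
    linearPart γ (x -ᵥ y) = γ x -ᵥ γ y :=
  γ.map_vsub x y

lemma IsInvariant.vsub_mem_iff (hW : IsInvariant (holonomyGroup G) W) {γ : E ≃ᵃⁱ[ℝ] E}
    (hγ : γ ∈ G) (x y : E) : γ x -ᵥ γ y ∈ W ↔ x -ᵥ y ∈ W := by
  refine ⟨fun h => ?_, fun h => ?_⟩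
  · have := hW _ (Subgroup.mem_map_of_mem linearPart (G.inv_mem hγ)) _ h
    rw [linearPart_vsub] at this
    simpa using this
  · rw [← linearPart_vsub]
    exact hW _ (Subgroup.mem_map_of_mem linearPart hγ) _ h

/-- An isometry in `G` preserves a coset of an invariant subspace as soon as it maps one point of
the coset into the coset. -/
lemma IsInvariant.mem_stabilizer_mk'_iff (hW : IsInvariant (holonomyGroup G) W) {o : E}
    {γ : E ≃ᵃⁱ[ℝ] E} : γ ∈ stabilizer G (mk' o W) ↔ γ ∈ G ∧ γ o -ᵥ o ∈ W := by
  refine ⟨fun ⟨hγ, h⟩ => ⟨hγ, ?_⟩, fun ⟨hγ, h⟩ => ⟨hγ, ?_⟩⟩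
  · have : γ o ∈ (mk' o W : Set E) := h ▸ Set.mem_image_of_mem γ (self_mem_mk' o W)
    exact mem_mk'.1 this
  · ext x
    have key : x -ᵥ o ∈ W ↔ x -ᵥ γ o ∈ W := by
      rw [← vsub_add_vsub_cancel x (γ o) o]
      exact W.add_mem_iff_left h
    constructor
    · rintro ⟨y, hy, rfl⟩
      exact mem_mk'.2 (key.2 ((hW.vsub_mem_iff hγ y o).2 (mem_mk'.1 hy)))
    · intro hx
      refine ⟨γ.symm x, mem_mk'.2 ?_, γ.apply_symm_apply x⟩
      rw [← hW.vsub_mem_iff hγ, γ.apply_symm_apply]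
      exact key.1 (mem_mk'.1 hx)

lemma stabilizer_le (G : Subgroup (E ≃ᵃⁱ[ℝ] E)) (F : AffineSubspace ℝ E) : stabilizer G F ≤ G :=
  fun _ h => h.1

/-- The form in which genericity is used: every displacement of a stabilizer element lies in `W`. -/
lemma IsGenericCoset.vsub_mem (hW : IsInvariant (holonomyGroup G) W) {F : AffineSubspace ℝ E}
    (hF : IsGenericCoset G W F) {γ : E ≃ᵃⁱ[ℝ] E} (hγ : γ ∈ stabilizer G F) (x : E) :
    γ x -ᵥ x ∈ W := by
  rw [hF.2] at hγ
  have := Subgroup.mem_iInf.1 (Subgroup.mem_iInf.1 (Subgroup.mem_inf.1 hγ).2 (mk' x W)) ⟨x, rfl⟩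
  exact (hW.mem_stabilizer_mk'_iff.1 this).2

/-- The displacement of `g h g⁻¹` at `o` is the linear part of `g` applied to the displacement of
`h` at `g⁻¹ o`, so invariance keeps it in `W`. -/
lemma normal_subgroupOf_stabilizer (hW : IsInvariant (holonomyGroup G) W) {o : E}
    (hS : ∀ γ ∈ stabilizer G (mk' o W), ∀ x, γ x -ᵥ x ∈ W) :
    ((stabilizer G (mk' o W)).subgroupOf G).Normal := by
  rw [Subgroup.normal_subgroupOf_iff (stabilizer_le _ _)]
  intro h g hh hg
  refine hW.mem_stabilizer_mk'_iff.2 ⟨G.mul_mem (G.mul_mem hg hh.1) (G.inv_mem hg), ?_⟩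
  have := (hW.vsub_mem_iff hg _ _).2 (hS h hh (g⁻¹ o))
  simpa using this

lemma normal_subgroupOf_sup {Γ : Type*} [Group Γ] {A B G : Subgroup Γ} (hA : A ≤ G) (hB : B ≤ G)
    [(A.subgroupOf G).Normal] [(B.subgroupOf G).Normal] : ((A ⊔ B).subgroupOf G).Normal := by
  rw [Subgroup.subgroupOf_sup hA hB]
  infer_instance

lemma exists_mul_of_mem_sup {Γ : Type*} [Group Γ] {A B G : Subgroup Γ} (hA : A ≤ G) (hB : B ≤ G)
    [(B.subgroupOf G).Normal] {g : Γ} (hg : g ∈ A ⊔ B) : ∃ a ∈ A, ∃ b ∈ B, a * b = g := by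
  have hgG : g ∈ G := sup_le hA hB hg
  have : (⟨g, hgG⟩ : G) ∈ A.subgroupOf G ⊔ B.subgroupOf G := by
    rw [← Subgroup.subgroupOf_sup hA hB]
    exact hg
  obtain ⟨a, ha, b, hb, hab⟩ := Subgroup.mem_sup_of_normal_right.1 this
  exact ⟨a, ha, b, hb, congrArg Subtype.val hab⟩

lemma proj_eq_iff {x y : E} : proj G x = proj G y ↔ ∃ γ ∈ G, γ x = y :=
  Quotient.eq (r := orbitSetoid G)

lemma mem_leaf_mk'_iff {o x : E} :
    proj G x ∈ leaf G (mk' o W) ↔ ∃ γ ∈ G, γ x -ᵥ o ∈ W := by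
  constructor
  · rintro ⟨y, hy, h⟩
    obtain ⟨γ, hγ, rfl⟩ := proj_eq_iff.1 h.symm
    exact ⟨γ, hγ, mem_mk'.1 hy⟩
  · rintro ⟨γ, hγ, h⟩
    exact ⟨γ x, mem_mk'.2 h, (proj_eq_iff.2 ⟨γ, hγ, rfl⟩).symm⟩

/-- The intersection of two transverse leaves corresponds to the quotient group, provided that
the stabilizers act leafwise. Here `P` is the projection onto `V₂` along `V₁`, so that
`P (γ o -ᵥ o) +ᵥ o` is the common point of `o + V₂` and `γ (o + V₁)`. -/
theorem exists_equiv_leaf_inter (hd : Disjoint V₁ V₂)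
    (hinv₁ : IsInvariant (holonomyGroup G) V₁) (hinv₂ : IsInvariant (holonomyGroup G) V₂)
    {P : V → V} (hP₁ : ∀ v, v - P v ∈ V₁) (hP₂ : ∀ v, P v ∈ V₂) {o : E}
    (hS₁ : ∀ γ ∈ stabilizer G (mk' o V₁), ∀ x, γ x -ᵥ x ∈ V₁)
    (hS₂ : ∀ γ ∈ stabilizer G (mk' o V₂), ∀ x, γ x -ᵥ x ∈ V₂) :
    ∃ Ψ : (G ⧸ (stabilizer G (mk' o V₁) ⊔ stabilizer G (mk' o V₂)).subgroupOf G) ≃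
        ↥(leaf G (mk' o V₁) ∩ leaf G (mk' o V₂)),
      ∀ γ : G, (Ψ (QuotientGroup.mk γ) : OrbitSpace G) =
        proj G (P ((γ : E ≃ᵃⁱ[ℝ] E) o -ᵥ o) +ᵥ o) := by
  set S₁ := stabilizer G (mk' o V₁) with hS₁def
  set S₂ := stabilizer G (mk' o V₂) with hS₂def
  have hle₁ : S₁ ≤ G := stabilizer_le _ _
  have hle₂ : S₂ ≤ G := stabilizer_le _ _
  have hn₁ : (S₁.subgroupOf G).Normal := normal_subgroupOf_stabilizer hinv₁ hS₁
  have hn₂ : (S₂.subgroupOf G).Normal := normal_subgroupOf_stabilizer hinv₂ hS₂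
  let f : (E ≃ᵃⁱ[ℝ] E) → E := fun γ => P (γ o -ᵥ o) +ᵥ o
  have hf₁ : ∀ γ, f γ -ᵥ γ o ∈ V₁ := fun γ => by
    have := V₁.neg_mem (hP₁ (γ o -ᵥ o))
    rwa [neg_sub, sub_eq_add_neg, neg_vsub_eq_vsub_rev, ← vadd_vsub_assoc] at this
  have hf₂ : ∀ γ, f γ -ᵥ o ∈ V₂ := fun γ => by simpa [f] using hP₂ (γ o -ᵥ o)
  -- Uniqueness of the common point of `γ (o + V₁)` and `o + V₂`, from `V₁ ∩ V₂ = 0`.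
  have hf : ∀ γ z, z -ᵥ γ o ∈ V₁ → z -ᵥ o ∈ V₂ → z = f γ := fun γ z h₁ h₂ => by
    refine vsub_eq_zero_iff_eq.1 (Submodule.disjoint_def.1 hd _ ?_ ?_)
    · rw [← vsub_sub_vsub_cancel_right z _ (γ o)]
      exact V₁.sub_mem h₁ (hf₁ γ)
    · rw [← vsub_sub_vsub_cancel_right z _ o]
      exact V₂.sub_mem h₂ (hf₂ γ)
  have hfmul₁ : ∀ γ ∈ G, ∀ s ∈ S₁, f (γ * s) = f γ := fun γ hγ s hs => by
    refine hf γ _ ?_ (hf₂ _)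
    rw [← vsub_add_vsub_cancel _ ((γ * s) o) _]
    exact V₁.add_mem (hf₁ _) ((hinv₁.vsub_mem_iff hγ _ _).2 (hS₁ s hs o))
  have hfmul₂ : ∀ γ ∈ G, ∀ s ∈ S₂, f (s * γ) = s (f γ) := fun γ _ s hs => by
    refine (hf _ _ ((hinv₁.vsub_mem_iff (hle₂ hs) (f γ) (γ o)).2 (hf₁ γ)) ?_).symm
    rw [← vsub_add_vsub_cancel _ (s o) _]
    exact V₂.add_mem ((hinv₂.vsub_mem_iff (hle₂ hs) _ _).2 (hf₂ γ)) (hS₂ s hs o)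
  have hmem : ∀ γ ∈ G, proj G (f γ) ∈ leaf G (mk' o V₁) ∩ leaf G (mk' o V₂) := fun γ hγ => by
    refine ⟨mem_leaf_mk'_iff.2 ⟨γ⁻¹, G.inv_mem hγ, ?_⟩,
      mem_leaf_mk'_iff.2 ⟨1, G.one_mem, hf₂ γ⟩⟩
    have := (hinv₁.vsub_mem_iff (G.inv_mem hγ) _ _).2 (hf₁ γ)
    simpa using this
  have hwd : ∀ γ γ' : G, γ⁻¹ * γ' ∈ (S₁ ⊔ S₂).subgroupOf G →
      proj G (f γ) = proj G (f γ') := fun γ γ' h => by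
    obtain ⟨s₂, hs₂, s₁, hs₁, h⟩ := exists_mul_of_mem_sup hle₂ hle₁ (sup_comm S₁ S₂ ▸ h)
    have hc : (γ * s₂ * γ⁻¹ : E ≃ᵃⁱ[ℝ] E) ∈ S₂ :=
      (Subgroup.normal_subgroupOf_iff hle₂).1 hn₂ s₂ γ hs₂ γ.2
    -- Normality of `S₂` rewrites `γ' = γ s₂ s₁` as an element of `S₂ γ S₁`, where right invariance
    -- under `S₁` and equivariance under `S₂` apply.
    have h' : (γ' : E ≃ᵃⁱ[ℝ] E) = (γ * s₂ * γ⁻¹) * γ * s₁ := by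
      rw [Subgroup.coe_inv, inv_mul_cancel_right, mul_assoc, h]
      simp
    refine proj_eq_iff.2 ⟨_, hle₂ hc, ?_⟩
    rw [h', hfmul₁ _ (G.mul_mem (hle₂ hc) γ.2) _ hs₁, hfmul₂ _ γ.2 _ hc]
  have hinj : ∀ γ γ' : G, proj G (f γ) = proj G (f γ') →
      γ⁻¹ * γ' ∈ (S₁ ⊔ S₂).subgroupOf G := fun γ γ' h => by
    obtain ⟨δ, hδ, h⟩ := proj_eq_iff.1 h
    -- `δ` maps `f γ` to `f γ'`, and both lie in `o + V₂`.
    have hδ₂ : δ ∈ S₂ := by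
      refine hinv₂.mem_stabilizer_mk'_iff.2 ⟨hδ, ?_⟩
      rw [← vsub_add_vsub_cancel _ (δ (f γ)) _]
      refine V₂.add_mem ((hinv₂.vsub_mem_iff hδ _ _).2 ?_) (h ▸ hf₂ γ')
      rw [← neg_vsub_eq_vsub_rev]
      exact V₂.neg_mem (hf₂ γ)
    -- The cosets `δ γ (o + V₁)` and `γ' (o + V₁)` share the point `f γ'`, so they coincide.
    have hs₁ : (γ' : E ≃ᵃⁱ[ℝ] E)⁻¹ * (δ * γ) ∈ S₁ := by
      refine hinv₁.mem_stabilizer_mk'_iff.2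
        ⟨G.mul_mem (G.inv_mem γ'.2) (G.mul_mem hδ γ.2), ?_⟩
      rw [← hinv₁.vsub_mem_iff γ'.2, ← vsub_add_vsub_cancel _ (δ (f γ)) _]
      refine V₁.add_mem ?_ (h ▸ hf₁ γ')
      have := V₁.neg_mem ((hinv₁.vsub_mem_iff hδ _ _).2 (hf₁ γ))
      simpa using this
    have hc : (γ⁻¹ * δ * γ⁻¹⁻¹ : E ≃ᵃⁱ[ℝ] E) ∈ S₂ :=
      (Subgroup.normal_subgroupOf_iff hle₂).1 hn₂ δ γ⁻¹ hδ₂ (G.inv_mem γ.2)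
    have := (S₁ ⊔ S₂).mul_mem (Subgroup.mem_sup_right (S := S₁) hc)
      (Subgroup.mem_sup_left (T := S₂) (S₁.inv_mem hs₁))
    rw [Subgroup.mem_subgroupOf]
    convert this using 1
    push_cast
    group
  let F : (G ⧸ (S₁ ⊔ S₂).subgroupOf G) → ↥(leaf G (mk' o V₁) ∩ leaf G (mk' o V₂)) :=
    Quotient.lift (fun γ : G => ⟨proj G (f γ), hmem γ γ.2⟩) fun γ γ' h =>
      Subtype.ext (hwd γ γ' (QuotientGroup.leftRel_apply.1 h))
  refine ⟨Equiv.ofBijective F ⟨?_, ?_⟩, fun γ => rfl⟩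
  · rintro ⟨γ⟩ ⟨γ'⟩ h
    exact QuotientGroup.eq.2 (hinj γ γ' (congrArg Subtype.val h))
  · rintro ⟨p, ⟨y, hy, rfl⟩, hp⟩
    obtain ⟨γ, hγ, h⟩ := mem_leaf_mk'_iff.1 hp
    refine ⟨QuotientGroup.mk ⟨γ, hγ⟩, Subtype.ext ?_⟩
    have : γ y = f γ := hf γ _ ((hinv₁.vsub_mem_iff hγ _ _).2 (mem_mk'.1 hy)) h
    exact (proj_eq_iff.2 ⟨γ, hγ, this⟩).symm

end Bijection

/-! ### Translation lattice, finiteness of holonomy and of the lattice quotient -/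

section Lattice

variable {V E : Type*} [NormedAddCommGroup V] [InnerProductSpace ℝ V]
  [MetricSpace E] [NormedAddTorsor V E] {Γ : Subgroup (E ≃ᵃⁱ[ℝ] E)} {W V₁ V₂ : Submodule ℝ V}

lemma constVAdd_mem_translations_iff {v : V} :
    AffineIsometryEquiv.constVAdd ℝ E v ∈ translations E W ↔ v ∈ W := by
  refine ⟨?_, fun h => ⟨v, h, rfl⟩⟩
  rintro ⟨w, hw, h⟩
  obtain ⟨x⟩ := (inferInstance : Nonempty E)
  have : v +ᵥ x = w +ᵥ x := DFunLike.congr_fun h x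
  rwa [vadd_right_cancel x this]

lemma constVAdd_mem_latticeSubgroup_iff {v : V} :
    AffineIsometryEquiv.constVAdd ℝ E v ∈ latticeSubgroup Γ ↔
      AffineIsometryEquiv.constVAdd ℝ E v ∈ Γ :=
  ⟨fun h => h.1, fun h => ⟨h, v, trivial, rfl⟩⟩

lemma linearPart_constVAdd (v : V) : linearPart (AffineIsometryEquiv.constVAdd ℝ E v) = 1 := by
  ext w
  obtain ⟨x⟩ := (inferInstance : Nonempty E)
  have := linearPart_vsub (AffineIsometryEquiv.constVAdd ℝ E v) (w +ᵥ x) x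
  rw [AffineIsometryEquiv.coe_constVAdd, vadd_vsub_vadd_cancel_left, vadd_vsub] at this
  exact this

lemma linearPart_eq_one_iff {γ : E ≃ᵃⁱ[ℝ] E} : linearPart γ = 1 ↔ γ ∈ translations E ⊤ := by
  constructor
  · intro h
    obtain ⟨o⟩ := (inferInstance : Nonempty E)
    refine ⟨γ o -ᵥ o, trivial, ?_⟩
    ext x
    have := linearPart_vsub γ x o
    rw [h] at this
    change x -ᵥ o = _ at this
    rw [AffineIsometryEquiv.coe_constVAdd, eq_vadd_iff_vsub_eq, ← vsub_add_vsub_cancel _ (γ o) x,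
      ← this, add_comm, vsub_add_vsub_cancel]
  · rintro ⟨v, -, rfl⟩
    exact linearPart_constVAdd v

lemma latticeSubgroup_eq_inf_ker : latticeSubgroup Γ = Γ ⊓ (linearPart (E := E)).ker := by
  ext γ
  simp only [latticeSubgroup, Subgroup.mem_inf, MonoidHom.mem_ker, linearPart_eq_one_iff]

lemma isInvariant_holonomyGroup_latticeSubgroup (W : Submodule ℝ V) :
    IsInvariant (holonomyGroup (latticeSubgroup Γ)) W := by
  rintro _ ⟨γ, hγ, rfl⟩ w hw
  rw [linearPart_eq_one_iff.2 hγ.2]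
  exact hw

/-- A translation preserves one coset of `W` iff its vector lies in `W`, and then it preserves all
of them. The stabilizer is thus independent of `o`. -/
lemma stabilizer_latticeSubgroup (o : E) (W : Submodule ℝ V) :
    stabilizer (latticeSubgroup Γ) (mk' o W) = latticeSubgroup Γ ⊓ translations E W := by
  ext γ
  rw [(isInvariant_holonomyGroup_latticeSubgroup W).mem_stabilizer_mk'_iff, Subgroup.mem_inf,
    and_congr_right_iff]
  rintro ⟨-, v, -, rfl⟩
  simp [constVAdd_mem_translations_iff]

lemma vsub_mem_of_mem_translations {γ : E ≃ᵃⁱ[ℝ] E} (h : γ ∈ translations E W) (x : E) :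
    γ x -ᵥ x ∈ W := by
  obtain ⟨w, hw, rfl⟩ := h
  simpa using hw

lemma constVAdd_add (v w : V) : AffineIsometryEquiv.constVAdd ℝ E (v + w) =
    AffineIsometryEquiv.constVAdd ℝ E v * AffineIsometryEquiv.constVAdd ℝ E w := by
  ext x
  simp [add_vadd]

lemma constVAdd_neg (v : V) : AffineIsometryEquiv.constVAdd ℝ E (-v) =
    (AffineIsometryEquiv.constVAdd ℝ E v)⁻¹ := by
  rw [eq_comm, inv_eq_iff_mul_eq_one, ← constVAdd_add, add_neg_cancel]
  ext x
  simp

/-- The vectors of the translations in `Γ`. -/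
def latticeVectors (Γ : Subgroup (E ≃ᵃⁱ[ℝ] E)) : AddSubgroup V where
  carrier := {v | AffineIsometryEquiv.constVAdd ℝ E v ∈ Γ}
  zero_mem' := by
    rw [Set.mem_ofPred_eq, AffineIsometryEquiv.constVAdd_zero]
    exact Γ.one_mem
  add_mem' hv hw := by
    rw [Set.mem_ofPred_eq, constVAdd_add]
    exact Γ.mul_mem hv hw
  neg_mem' hv := by
    rw [Set.mem_ofPred_eq, constVAdd_neg]
    exact Γ.inv_mem hv

lemma mem_latticeVectors_iff {v : V} :
    v ∈ latticeVectors Γ ↔ AffineIsometryEquiv.constVAdd ℝ E v ∈ Γ :=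
  Iff.rfl

lemma continuous_constVAdd :
    Continuous (fun v : V => (AffineIsometryEquiv.constVAdd ℝ E v : E ≃ᵃⁱ[ℝ] E)) := by
  refine continuous_induced_rng.2 (ContinuousMap.continuous_of_continuous_uncurry _ ?_)
  change Continuous fun p : V × E => p.1 +ᵥ p.2
  fun_prop

lemma discreteTopology_latticeVectors (hΓ : DiscreteTopology Γ) :
    DiscreteTopology (latticeVectors Γ) := by
  refine DiscreteTopology.of_continuous_injective (β := Γ)
    (f := fun v => ⟨AffineIsometryEquiv.constVAdd ℝ E (v : V), v.2⟩) ?_ ?_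
  · exact (continuous_constVAdd.comp continuous_subtype_val).subtype_mk _
  · intro v w h
    obtain ⟨x⟩ := (inferInstance : Nonempty E)
    have : (v : V) +ᵥ x = (w : V) +ᵥ x := DFunLike.congr_fun (congrArg Subtype.val h) x
    exact Subtype.ext (vadd_right_cancel x this)

lemma finite_latticeVectors_norm_le [FiniteDimensional ℝ V] (hΓ : DiscreteTopology Γ) (R : ℝ) :
    {v : V | v ∈ latticeVectors Γ ∧ ‖v‖ ≤ R}.Finite := by
  have := discreteTopology_latticeVectors hΓ
  have hc : IsClosed (latticeVectors Γ : Set V) := AddSubgroup.isClosed_of_discrete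
  refine (Metric.finite_isBounded_inter_isClosed (K := Metric.closedBall (0 : V) R)
    (s := (latticeVectors Γ : Set V)) DiscreteTopology.isDiscrete
    Metric.isBounded_closedBall hc).subset ?_
  rintro v ⟨hv, hR⟩
  exact ⟨mem_closedBall_zero_iff.2 hR, hv⟩

/-- A space that is the sum of two `L`-subspaces has a basis of lattice vectors lying in them. -/
lemma exists_basis_latticeVectors (hV : Codisjoint V₁ V₂)
    (h₁ : IsLSubspace (latticeSubgroup Γ) V₁) (h₂ : IsLSubspace (latticeSubgroup Γ) V₂) :
    ∃ (s : Set V) (b : Basis s ℝ V), ∀ i, b i ∈ latticeVectors Γ ∧ (b i ∈ V₁ ∨ b i ∈ V₂) := by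
  let t : Set V := {v | v ∈ latticeVectors Γ ∧ (v ∈ V₁ ∨ v ∈ V₂)}
  have ht : ⊤ ≤ Submodule.span ℝ t := by
    rw [← hV.eq_top, sup_le_iff]
    constructor
    · rw [← h₁]
      exact Submodule.span_mono fun v hv => ⟨hv.2.1, Or.inl (h₁ ▸ Submodule.subset_span hv)⟩
    · rw [← h₂]
      exact Submodule.span_mono fun v hv => ⟨hv.2.1, Or.inr (h₂ ▸ Submodule.subset_span hv)⟩
  exact ⟨_, Basis.ofSpan ht, fun i => Basis.ofSpan_subset ht ⟨i, rfl⟩⟩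

lemma linearPart_mem_latticeVectors {γ : E ≃ᵃⁱ[ℝ] E} (hγ : γ ∈ Γ) {v : V}
    (hv : v ∈ latticeVectors Γ) : linearPart γ v ∈ latticeVectors Γ := by
  have h := Γ.mul_mem (Γ.mul_mem hγ hv) (Γ.inv_mem hγ)
  rw [mem_latticeVectors_iff]
  convert h using 1
  ext x
  have := linearPart_vsub γ (v +ᵥ γ⁻¹ x) (γ⁻¹ x)
  rw [vadd_vsub] at this
  rw [AffineIsometryEquiv.coe_constVAdd, this]
  simp

/-- A holonomy element preserves norms and lattice vectors, so each `b i` has finitely many possible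
images, and these determine the element. -/
theorem finite_holonomyGroup [FiniteDimensional ℝ V] (hΓ : DiscreteTopology Γ) {ι : Type*}
    (b : Basis ι ℝ V) (hb : ∀ i, b i ∈ latticeVectors Γ) : Finite (holonomyGroup Γ) := by
  have : Finite ι := Module.Finite.finite_basis b
  have hfin : ∀ i, Finite {v : V | v ∈ latticeVectors Γ ∧ ‖v‖ ≤ ‖b i‖} := fun i =>
    finite_latticeVectors_norm_le hΓ _
  let F : holonomyGroup Γ → ∀ i, {v : V | v ∈ latticeVectors Γ ∧ ‖v‖ ≤ ‖b i‖} :=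
    fun A i => ⟨(A : V ≃ₗᵢ[ℝ] V) (b i), by
      obtain ⟨_, γ, hγ, rfl⟩ := A
      exact ⟨linearPart_mem_latticeVectors hγ (hb i), (LinearIsometryEquiv.norm_map _ _).le⟩⟩
  refine Finite.of_injective F fun A B h => Subtype.ext ?_
  refine LinearIsometryEquiv.toLinearEquiv_injective (LinearEquiv.toLinearMap_injective ?_)
  exact b.ext fun i => congrArg Subtype.val (congrFun h i)

/-- The integer span of `b` acts by translations in the subgroup divided out, so each class is
represented by a fractional part, a lattice vector of norm at most `∑ i, ‖b i‖`. -/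
theorem finite_latticeSubgroup_quotient [FiniteDimensional ℝ V] (hΓ : DiscreteTopology Γ)
    {ι : Type*} (b : Basis ι ℝ V) (hb : ∀ i, b i ∈ latticeVectors Γ ∧ (b i ∈ V₁ ∨ b i ∈ V₂)) :
    Finite (latticeSubgroup Γ ⧸ ((latticeSubgroup Γ ⊓ translations E V₁) ⊔
      (latticeSubgroup Γ ⊓ translations E V₂)).subgroupOf (latticeSubgroup Γ)) := by
  have : Finite ι := Module.Finite.finite_basis b
  have := Fintype.ofFinite ι
  set N := (latticeSubgroup Γ ⊓ translations E V₁) ⊔ (latticeSubgroup Γ ⊓ translations E V₂)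
  have hN : ∀ v ∈ Submodule.span ℤ (Set.range b), AffineIsometryEquiv.constVAdd ℝ E v ∈ N := by
    intro v hv
    have : Submodule.span ℤ (Set.range b) ≤ AddSubgroup.toIntSubmodule (latticeVectors N) := by
      rw [Submodule.span_le]
      rintro _ ⟨i, rfl⟩
      have h := constVAdd_mem_latticeSubgroup_iff.2 (hb i).1
      rcases (hb i).2 with hi | hi
      · exact Subgroup.mem_sup_left ⟨h, constVAdd_mem_translations_iff.2 hi⟩
      · exact Subgroup.mem_sup_right ⟨h, constVAdd_mem_translations_iff.2 hi⟩
    exact this hv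
  have hΛ : ∀ v ∈ Submodule.span ℤ (Set.range b), v ∈ latticeVectors Γ := fun v hv =>
    (sup_le inf_le_left inf_le_left : N ≤ latticeSubgroup Γ) (hN v hv) |>.1
  have hfin : Finite {v : V | v ∈ latticeVectors Γ ∧ ‖v‖ ≤ ∑ i, ‖b i‖} :=
    finite_latticeVectors_norm_le hΓ _
  let F : {v : V | v ∈ latticeVectors Γ ∧ ‖v‖ ≤ ∑ i, ‖b i‖} →
      latticeSubgroup Γ ⧸ N.subgroupOf (latticeSubgroup Γ) := fun v =>
    QuotientGroup.mk ⟨_, constVAdd_mem_latticeSubgroup_iff.2 v.2.1⟩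
  refine Finite.of_surjective F ?_
  rintro ⟨⟨_, hγ, v, -, rfl⟩⟩
  refine ⟨⟨ZSpan.fract b v, ?_, ZSpan.norm_fract_le b v⟩, ?_⟩
  · exact (latticeVectors Γ).sub_mem hγ (hΛ _ (ZSpan.floor b v).2)
  · refine QuotientGroup.eq.2 (Subgroup.mem_subgroupOf.2 ?_)
    convert hN _ (ZSpan.floor b v).2 using 1
    push_cast
    rw [inv_mul_eq_iff_eq_mul, ← constVAdd_add, ZSpan.fract_apply, sub_add_cancel]

end Lattice

/-! ### Index formula and translations in the product of the stabilizers -/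

section Generic

lemma normal_subgroupOf_map {G K : Type*} [Group G] [Group K] (f : G →* K)
    {Γ N : Subgroup G} (hN : N ≤ Γ) [hn : (N.subgroupOf Γ).Normal] :
    ((N.map f).subgroupOf (Γ.map f)).Normal := by
  rw [Subgroup.normal_subgroupOf_iff (Subgroup.map_mono hN)]
  rintro _ _ ⟨h, hh, rfl⟩ ⟨g, hg, rfl⟩
  exact ⟨g * h * g⁻¹, (Subgroup.normal_subgroupOf_iff hN).1 hn h g hh hg, by simp⟩

/-- With `g` the restriction of `f` to `Γ`, the index of `N` factors through `N · ker g`: the lower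
step is the index of `N ∩ ker g` in `ker g`, the upper one is the index of the images. -/
lemma relIndex_eq_relIndex_inf_ker_mul {G K : Type*} [Group G] [Group K] (f : G →* K)
    {Γ N : Subgroup G} (hN : N ≤ Γ) [hn : (N.subgroupOf Γ).Normal] :
    N.relIndex Γ = N.relIndex (Γ ⊓ f.ker) * (N.map f).relIndex (Γ.map f) := by
  let g : Γ →* K := f.comp Γ.subtype
  have hg : g.ker = (Γ ⊓ f.ker).subgroupOf Γ := by
    ext x
    simp [g, Subgroup.mem_subgroupOf, MonoidHom.mem_ker]
  have hNg : (N.subgroupOf Γ).map g = N.map f := by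
    rw [← Subgroup.map_map, Subgroup.map_subgroupOf_eq_of_le hN]
  have hΓg : (⊤ : Subgroup Γ).map g = Γ.map f := by
    rw [← Subgroup.map_map, ← MonoidHom.range_eq_map, Subgroup.range_subtype]
  have h₁ := Subgroup.relIndex_map_map g (N.subgroupOf Γ) ⊤
  rw [hNg, hΓg, top_sup_eq, Subgroup.relIndex_top_right] at h₁
  have h₂ := Subgroup.relIndex_mul_index (le_sup_left : N.subgroupOf Γ ≤ N.subgroupOf Γ ⊔ g.ker)
  rw [Subgroup.relIndex_sup_left, ← h₁, hg, Subgroup.relIndex_subgroupOf inf_le_left] at h₂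
  exact h₂.symm

variable {V E : Type*} [NormedAddCommGroup V] [InnerProductSpace ℝ V]
  [MetricSpace E] [NormedAddTorsor V E] {Γ : Subgroup (E ≃ᵃⁱ[ℝ] E)} {V₁ V₂ : Submodule ℝ V}

lemma IsCoset.exists_eq_mk' (hV : Codisjoint V₁ V₂) {E₁ E₂ : AffineSubspace ℝ E}
    (h₁ : IsCoset V₁ E₁) (h₂ : IsCoset V₂ E₂) : ∃ o, E₁ = mk' o V₁ ∧ E₂ = mk' o V₂ := by
  obtain ⟨x₁, rfl⟩ := h₁
  obtain ⟨x₂, rfl⟩ := h₂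
  obtain ⟨v₁, h₁, v₂, h₂, h⟩ := Submodule.mem_sup.1
    (hV.eq_top ▸ Submodule.mem_top : x₂ -ᵥ x₁ ∈ V₁ ⊔ V₂)
  refine ⟨v₁ +ᵥ x₁, ?_, ?_⟩
  · conv_rhs => rw [← direction_mk' x₁ V₁]
    exact (mk'_eq (vadd_mem_mk' x₁ h₁)).symm
  · conv_rhs => rw [← direction_mk' x₂ V₂]
    refine (mk'_eq (mem_mk'.2 ?_)).symm
    have : (v₁ +ᵥ x₁) -ᵥ x₂ = -v₂ := by
      rw [vadd_vsub_assoc, ← neg_vsub_eq_vsub_rev, ← h]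
      abel
    rw [this]
    exact V₂.neg_mem h₂

/-- A pointwise choice suffices; linearity of `P` plays no role. -/
lemma exists_projection (hV : Codisjoint V₁ V₂) :
    ∃ P : V → V, (∀ v, v - P v ∈ V₁) ∧ ∀ v, P v ∈ V₂ := by
  have h : ∀ v : V, ∃ w, v - w ∈ V₁ ∧ w ∈ V₂ := fun v => by
    obtain ⟨v₁, h₁, v₂, h₂, rfl⟩ := Submodule.mem_sup.1
      (hV.eq_top ▸ Submodule.mem_top : v ∈ V₁ ⊔ V₂)
    exact ⟨v₂, by simpa using h₁, h₂⟩
  choose P hP using h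
  exact ⟨P, fun v => (hP v).1, fun v => (hP v).2⟩

/-- An isometry preserving all cosets of `V₁` has a linear part fixing `V₂` pointwise. -/
lemma linearPart_eq_self (hd : Disjoint V₁ V₂) (hinv₂ : IsInvariant (holonomyGroup Γ) V₂)
    {γ : E ≃ᵃⁱ[ℝ] E} (hγ : γ ∈ Γ) (h : ∀ x, γ x -ᵥ x ∈ V₁) {v : V} (hv : v ∈ V₂) :
    linearPart γ v = v := by
  obtain ⟨x⟩ := (inferInstance : Nonempty E)
  -- The difference of `linearPart γ v` and `v` is in `V₂` by invariance, and in `V₁` as a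
  -- difference of two displacements of `γ`.
  refine sub_eq_zero.1 (Submodule.disjoint_def.1 hd _ ?_
    (V₂.sub_mem (hinv₂ _ (Subgroup.mem_map_of_mem linearPart hγ) _ hv) hv))
  have key := V₁.sub_mem (h (v +ᵥ x)) (h x)
  have := linearPart_vsub γ (v +ᵥ x) x
  rw [vadd_vsub] at this
  rwa [vsub_sub_vsub_comm, ← this, vadd_vsub] at key

/-- A translation in the product of the two leafwise acting groups is a product of translations
in the two groups. -/
lemma latticeSubgroup_inf_sup (hV : IsCompl V₁ V₂)
    (hinv₁ : IsInvariant (holonomyGroup Γ) V₁) (hinv₂ : IsInvariant (holonomyGroup Γ) V₂) {o : E}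
    (hS₁ : ∀ γ ∈ stabilizer Γ (mk' o V₁), ∀ x, γ x -ᵥ x ∈ V₁)
    (hS₂ : ∀ γ ∈ stabilizer Γ (mk' o V₂), ∀ x, γ x -ᵥ x ∈ V₂) :
    latticeSubgroup Γ ⊓ (stabilizer Γ (mk' o V₁) ⊔ stabilizer Γ (mk' o V₂)) =
      (latticeSubgroup Γ ⊓ translations E V₁) ⊔ (latticeSubgroup Γ ⊓ translations E V₂) := by
  apply le_antisymm
  · rintro γ ⟨hγL, hγ⟩
    have := normal_subgroupOf_stabilizer hinv₂ hS₂
    obtain ⟨a, ha, b, hb, rfl⟩ := exists_mul_of_mem_sup (stabilizer_le _ _) (stabilizer_le _ _) hγ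
    have ha₂ : ∀ v ∈ V₂, linearPart a v = v := fun v hv =>
      linearPart_eq_self hV.disjoint hinv₂ ha.1 (hS₁ a ha) hv
    have hb₁ : ∀ v ∈ V₁, linearPart b v = v := fun v hv =>
      linearPart_eq_self hV.disjoint.symm hinv₁ hb.1 (hS₂ b hb) hv
    have hab : linearPart a * linearPart b = 1 := by
      rw [← map_mul]
      exact linearPart_eq_one_iff.2 hγL.2
    -- On `V₁` the part of `b` is trivial, so `hab` forces that of `a` to be trivial there; on `V₂`
    -- it is already trivial.
    have ha1 : linearPart a = 1 := by
      ext v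
      obtain ⟨v₁, h₁, v₂, h₂, rfl⟩ := Submodule.mem_sup.1
        (hV.sup_eq_top ▸ Submodule.mem_top : v ∈ V₁ ⊔ V₂)
      have h := DFunLike.congr_fun hab v₁
      change linearPart a (linearPart b v₁) = v₁ at h
      rw [hb₁ v₁ h₁] at h
      rw [map_add, h, ha₂ v₂ h₂]
      rfl
    have hb1 : linearPart b = 1 := by rwa [ha1, one_mul] at hab
    have haL : a ∈ latticeSubgroup Γ := ⟨ha.1, linearPart_eq_one_iff.1 ha1⟩
    have hbL : b ∈ latticeSubgroup Γ := ⟨hb.1, linearPart_eq_one_iff.1 hb1⟩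
    refine mul_mem (Subgroup.mem_sup_left ?_) (Subgroup.mem_sup_right ?_)
    · rw [← stabilizer_latticeSubgroup o]
      exact ⟨haL, ha.2⟩
    · rw [← stabilizer_latticeSubgroup o]
      exact ⟨hbL, hb.2⟩
  · rw [← stabilizer_latticeSubgroup o, ← stabilizer_latticeSubgroup o]
    exact le_inf (sup_le (stabilizer_le _ _) (stabilizer_le _ _))
      (sup_le_sup (fun γ h => ⟨h.1.1, h.2⟩) fun γ h => ⟨h.1.1, h.2⟩)

/-- The intersection of two transverse leaves of the torus corresponds to a quotient of the
lattice. -/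
theorem exists_equiv_torus_leaf_inter (hd : Disjoint V₁ V₂)
    {P : V → V} (hP₁ : ∀ v, v - P v ∈ V₁) (hP₂ : ∀ v, P v ∈ V₂) (o : E) :
    ∃ Ψ : (latticeSubgroup Γ ⧸ ((latticeSubgroup Γ ⊓ translations E V₁) ⊔
          (latticeSubgroup Γ ⊓ translations E V₂)).subgroupOf (latticeSubgroup Γ)) ≃
        ↥(leaf (latticeSubgroup Γ) (mk' o V₁) ∩ leaf (latticeSubgroup Γ) (mk' o V₂)),
      ∀ γ : latticeSubgroup Γ, (Ψ (QuotientGroup.mk γ) : OrbitSpace (latticeSubgroup Γ)) =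
        proj (latticeSubgroup Γ) (P ((γ : E ≃ᵃⁱ[ℝ] E) o -ᵥ o) +ᵥ o) := by
  have hS : ∀ W : Submodule ℝ V, ∀ γ ∈ stabilizer (latticeSubgroup Γ) (mk' o W),
      ∀ x, γ x -ᵥ x ∈ W := fun W γ hγ => by
    rw [stabilizer_latticeSubgroup] at hγ
    exact vsub_mem_of_mem_translations hγ.2
  have := exists_equiv_leaf_inter hd (isInvariant_holonomyGroup_latticeSubgroup (Γ := Γ) V₁)
    (isInvariant_holonomyGroup_latticeSubgroup V₂) hP₁ hP₂ (hS V₁) (hS V₂)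
  rwa [stabilizer_latticeSubgroup, stabilizer_latticeSubgroup] at this

end Generic

end FlatManifold

theorem mainTheorem4 {V E : Type*} [NormedAddCommGroup V] [InnerProductSpace ℝ V]
    [FiniteDimensional ℝ V] [MetricSpace E] [NormedAddTorsor V E]
    (Γ : Subgroup (E ≃ᵃⁱ[ℝ] E)) (hΓ : FlatManifold.IsBieberbach Γ)
    (V₁ V₂ : Submodule ℝ V) (hcompl : IsCompl V₁ V₂)
    (hinv₁ : FlatManifold.IsInvariant (FlatManifold.holonomyGroup Γ) V₁)
    (hinv₂ : FlatManifold.IsInvariant (FlatManifold.holonomyGroup Γ) V₂)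
    (hspan₁ : FlatManifold.IsLSubspace (FlatManifold.latticeSubgroup Γ) V₁)
    (hspan₂ : FlatManifold.IsLSubspace (FlatManifold.latticeSubgroup Γ) V₂) :
    let L := FlatManifold.latticeSubgroup Γ
    let L₁ := L ⊓ FlatManifold.translations E V₁
    let L₂ := L ⊓ FlatManifold.translations E V₂
    -- intersections of generic leaves, and of the corresponding subtori
    (∀ E₁ E₂ : AffineSubspace ℝ E,
      FlatManifold.IsGenericCoset Γ V₁ E₁ → FlatManifold.IsGenericCoset Γ V₂ E₂ →
      let Γ₁ := FlatManifold.stabilizer Γ E₁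
      let Γ₂ := FlatManifold.stabilizer Γ E₂
      let H := FlatManifold.holonomyGroup Γ
      let H₁ := FlatManifold.holonomyGroup Γ₁
      let H₂ := FlatManifold.holonomyGroup Γ₂
      let M₁ := FlatManifold.leaf Γ E₁
      let M₂ := FlatManifold.leaf Γ E₂
      let T₁ := FlatManifold.leaf L E₁
      let T₂ := FlatManifold.leaf L E₂
      -- the three quotients are groups
      ∃ (_ : ((Γ₁ ⊔ Γ₂).subgroupOf Γ).Normal) (_ : ((L₁ ⊔ L₂).subgroupOf L).Normal)
        (_ : ((H₁ ⊔ H₂).subgroupOf H).Normal),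
        (M₁ ∩ M₂).Finite ∧ (T₁ ∩ T₂).Finite ∧
        -- the bijections with the quotient groups, and their compatibility with the projection
        (∃ (ΨM : (Γ ⧸ (Γ₁ ⊔ Γ₂).subgroupOf Γ) ≃ ↥(M₁ ∩ M₂))
            (ΨT : (L ⧸ (L₁ ⊔ L₂).subgroupOf L) ≃ ↥(T₁ ∩ T₂))
            (φ : (L ⧸ (L₁ ⊔ L₂).subgroupOf L) →* (Γ ⧸ (Γ₁ ⊔ Γ₂).subgroupOf Γ)),
            (∀ (γ : E ≃ᵃⁱ[ℝ] E) (hL : γ ∈ L) (hΓ' : γ ∈ Γ),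
              φ (QuotientGroup.mk ⟨γ, hL⟩) = QuotientGroup.mk ⟨γ, hΓ'⟩) ∧
            ∀ a, FlatManifold.torusProj Γ (ΨT a : FlatManifold.OrbitSpace L) = ΨM (φ a)) ∧
        Set.MapsTo (FlatManifold.torusProj Γ) (T₁ ∩ T₂) (M₁ ∩ M₂) ∧
        Set.InjOn (FlatManifold.torusProj Γ) (T₁ ∩ T₂) ∧
        Finite (H ⧸ (H₁ ⊔ H₂).subgroupOf H) ∧
        (M₁ ∩ M₂).ncard = (T₁ ∩ T₂).ncard * Nat.card (H ⧸ (H₁ ⊔ H₂).subgroupOf H)) ∧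
    -- the claim about the subtori for arbitrary, not necessarily generic, cosets
    (∀ E₁ E₂ : AffineSubspace ℝ E,
      FlatManifold.IsCoset V₁ E₁ → FlatManifold.IsCoset V₂ E₂ →
      (FlatManifold.leaf L E₁ ∩ FlatManifold.leaf L E₂).Finite ∧
      Nonempty ((L ⧸ (L₁ ⊔ L₂).subgroupOf L) ≃
        ↥(FlatManifold.leaf L E₁ ∩ FlatManifold.leaf L E₂))) := by
  intro L L₁ L₂
  obtain ⟨s, b, hb⟩ := FlatManifold.exists_basis_latticeVectors hcompl.codisjoint hspan₁ hspan₂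
  obtain ⟨P, hP₁, hP₂⟩ := FlatManifold.exists_projection hcompl.codisjoint
  have hfinL : Finite (L ⧸ (L₁ ⊔ L₂).subgroupOf L) :=
    FlatManifold.finite_latticeSubgroup_quotient hΓ.discrete b hb
  refine ⟨fun E₁ E₂ hE₁ hE₂ => ?_, fun E₁ E₂ hE₁ hE₂ => ?_⟩
  · intro Γ₁ Γ₂ H H₁ H₂ M₁ M₂ T₁ T₂
    have hS₁ : ∀ γ ∈ Γ₁, ∀ x, γ x -ᵥ x ∈ V₁ := fun γ => hE₁.vsub_mem hinv₁
    have hS₂ : ∀ γ ∈ Γ₂, ∀ x, γ x -ᵥ x ∈ V₂ := fun γ => hE₂.vsub_mem hinv₂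
    obtain ⟨o, rfl, rfl⟩ := hE₁.1.exists_eq_mk' hcompl.codisjoint hE₂.1
    have hle₁ : Γ₁ ≤ Γ := FlatManifold.stabilizer_le _ _
    have hle₂ : Γ₂ ≤ Γ := FlatManifold.stabilizer_le _ _
    have hle : Γ₁ ⊔ Γ₂ ≤ Γ := sup_le hle₁ hle₂
    have hn₁ : (Γ₁.subgroupOf Γ).Normal := FlatManifold.normal_subgroupOf_stabilizer hinv₁ hS₁
    have hn₂ : (Γ₂.subgroupOf Γ).Normal := FlatManifold.normal_subgroupOf_stabilizer hinv₂ hS₂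
    have hn : ((Γ₁ ⊔ Γ₂).subgroupOf Γ).Normal := FlatManifold.normal_subgroupOf_sup hle₁ hle₂
    have hLN : L ⊓ (Γ₁ ⊔ Γ₂) = L₁ ⊔ L₂ :=
      FlatManifold.latticeSubgroup_inf_sup hcompl hinv₁ hinv₂ hS₁ hS₂
    have hLle : L ≤ Γ := inf_le_left
    have hnL : ((L₁ ⊔ L₂).subgroupOf L).Normal := by
      rw [Subgroup.normal_subgroupOf_iff (sup_le inf_le_left inf_le_left), ← hLN]
      intro h g hh hg
      exact ⟨L.mul_mem (L.mul_mem hg hh.1) (L.inv_mem hg),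
        (Subgroup.normal_subgroupOf_iff hle).1 hn h g hh.2 (hLle hg)⟩
    have hH : H₁ ⊔ H₂ = (Γ₁ ⊔ Γ₂).map FlatManifold.linearPart := (Subgroup.map_sup _ _ _).symm
    have hnH : ((H₁ ⊔ H₂).subgroupOf H).Normal := by
      rw [hH]
      exact FlatManifold.normal_subgroupOf_map _ hle
    obtain ⟨ΨM, hΨM⟩ :=
      FlatManifold.exists_equiv_leaf_inter hcompl.disjoint hinv₁ hinv₂ hP₁ hP₂ hS₁ hS₂
    obtain ⟨ΨT, hΨT⟩ := FlatManifold.exists_equiv_torus_leaf_inter (Γ := Γ) hcompl.disjoint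
      hP₁ hP₂ o
    have hfinHol : Finite H := FlatManifold.finite_holonomyGroup hΓ.discrete b fun i => (hb i).1
    have hfinH : Finite (H ⧸ (H₁ ⊔ H₂).subgroupOf H) := inferInstance
    have hcard : Nat.card (Γ ⧸ (Γ₁ ⊔ Γ₂).subgroupOf Γ) =
        Nat.card (L ⧸ (L₁ ⊔ L₂).subgroupOf L) * Nat.card (H ⧸ (H₁ ⊔ H₂).subgroupOf H) := by
      have h := FlatManifold.relIndex_eq_relIndex_inf_ker_mul
        (FlatManifold.linearPart (E := E)) hle
      rw [← FlatManifold.latticeSubgroup_eq_inf_ker, ← hH,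
        ← Subgroup.inf_relIndex_left L (Γ₁ ⊔ Γ₂), hLN] at h
      exact h
    have hfinΓ : Finite (Γ ⧸ (Γ₁ ⊔ Γ₂).subgroupOf Γ) := by
      -- `Nat.card` is `0` on infinite types, so the nonzero product in `hcard` yields finiteness.
      refine Nat.finite_of_card_ne_zero ?_
      rw [hcard]
      exact mul_ne_zero Nat.card_pos.ne' Nat.card_pos.ne'
    let φ : (L ⧸ (L₁ ⊔ L₂).subgroupOf L) →* (Γ ⧸ (Γ₁ ⊔ Γ₂).subgroupOf Γ) :=
      QuotientGroup.map _ _ (Subgroup.inclusion hLle) fun γ hγ =>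
        (hLN.ge (Subgroup.mem_subgroupOf.1 hγ)).2
    -- The kernel of `φ` is the image of `L ∩ Γ₁Γ₂`, which is `L₁L₂`.
    have hφ : Function.Injective φ := by
      rw [injective_iff_map_eq_one]
      rintro ⟨γ⟩ h
      exact (QuotientGroup.eq_one_iff γ).2
        (hLN.le ⟨γ.2, (QuotientGroup.eq_one_iff (Subgroup.inclusion hLle γ)).1 h⟩)
    -- Both bijections use the same `P` and `o`, hence the same representative point in `E`.
    have hcomm : ∀ a, FlatManifold.torusProj Γ (ΨT a : FlatManifold.OrbitSpace L) =
        ΨM (φ a) := by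
      rintro ⟨γ⟩
      exact (congrArg (FlatManifold.torusProj Γ) (hΨT γ)).trans
        (hΨM (Subgroup.inclusion hLle γ)).symm
    refine ⟨hn, hnL, hnH, Finite.of_equiv _ ΨM, Finite.of_equiv _ ΨT,
      ⟨ΨM, ΨT, φ, fun _ _ _ => rfl, hcomm⟩, ?_, ?_, hfinH, ?_⟩
    · intro p hp
      obtain ⟨a, ha⟩ := ΨT.surjective ⟨p, hp⟩
      have := hcomm a
      rw [ha] at this
      exact this ▸ (ΨM (φ a)).2
    · intro p hp q hq h
      obtain ⟨a, ha⟩ := ΨT.surjective ⟨p, hp⟩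
      obtain ⟨c, hc⟩ := ΨT.surjective ⟨q, hq⟩
      have h₁ := hcomm a
      have h₂ := hcomm c
      rw [ha] at h₁
      rw [hc] at h₂
      have : a = c := hφ (ΨM.injective (Subtype.ext (h₁.symm.trans (h.trans h₂))))
      rw [this, hc] at ha
      exact (congrArg Subtype.val ha).symm
    · rw [← Nat.card_coe_set_eq, ← Nat.card_coe_set_eq, ← Nat.card_congr ΨM,
        ← Nat.card_congr ΨT, hcard]
  · obtain ⟨o, rfl, rfl⟩ := hE₁.exists_eq_mk' hcompl.codisjoint hE₂
    obtain ⟨Ψ, -⟩ := FlatManifold.exists_equiv_torus_leaf_inter (Γ := Γ) hcompl.disjoint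
      hP₁ hP₂ o
    exact ⟨Finite.of_equiv _ Ψ, ⟨Ψ⟩⟩
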